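/- Let $\mathbb{H}=\{z\in\mathbb{C}:\operatorname{Im} z>0\}$, with pseudo-hyperbolic distance $d(z,w)=\left|\frac{w-z}{w-\overline{z}}\right|$. Let $\phi$ be an analytic function on $\mathbb{H}$ with $\operatorname{Im}\phi\ge 0$ such that $\phi(z)\to\infty$ and $\phi(z)/z\to 1$ as $z\to\infty$ non-tangentially, that is, within each sector $\{|\operatorname{Arg} z-\pi/2|<\theta_0\}$ with $0<\theta_0<\pi/2$ (such a $\phi$ maps $\mathbb{H}$ into $\mathbb{H}$). Write $\phi_n$ for the $n$-th iterate of $\phi$ and $z_n=\phi_n(i)$. Assume that $\phi$ is of type Ia, i.e. $\lim_{n\to\infty} d(z_n,z_{n+1})>0$ and $\lim_{n\to\infty}\operatorname{Im} z_n<\infty$, and that for some $z_0^*\in\mathbb{H}$ (for instance $z_0^*=i$) the forward iterates satisfy $\operatorname{Arg}\phi_n(z_0^*)\to 0$ as $n\to\infty$. Then there is no backward-iteration sequence with bounded steps tending to infinity whose argument also tends to $0$; that is, there is no sequence $\{w_n\}_{n=0}^\infty\subset\mathbb{H}$ such that $\phi(w_{n+1})=w_n$ for all $n\ge 0$, $d(w_n,w_{n+1})\le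 a$ for all $n\ge 0$ and some constant $a<1$, $w_n\to\infty$, and $\operatorname{Arg} w_n\to 0$. -/

import Mathlib

open Filter Topology

/-- The filter of non-tangential approach to `∞` in the sector
`|Arg z - π/2| < θ` of the upper half-plane. -/
noncomputable def sectorAtInfinity (θ : ℝ) : Filter ℂ :=
  Bornology.cobounded ℂ ⊓ 𝓟 {z : ℂ | |Complex.arg z - Real.pi / 2| < θ}

/-- `φ` (restricted to the open upper half-plane) is an analytic map with `Im φ ≥ 0` that is
parabolic with Denjoy-Wolff point `∞`: `φ z → ∞` and `φ z / z → 1` as `z → ∞`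
non-tangentially. The values of `φ` off the open upper half-plane play no role. -/
structure IsParabolicAtInfinity (φ : ℂ → ℂ) : Prop where
  analytic : AnalyticOnNhd ℂ φ {z : ℂ | 0 < z.im}
  im_nonneg : ∀ z : ℂ, 0 < z.im → 0 ≤ (φ z).im
  tendsto_infinity : ∀ θ : ℝ, 0 < θ → θ < Real.pi / 2 →
    Tendsto φ (sectorAtInfinity θ) (Bornology.cobounded ℂ)
  tendsto_div : ∀ θ : ℝ, 0 < θ → θ < Real.pi / 2 →
    Tendsto (fun z => φ z / z) (sectorAtInfinity θ) (𝓝 1)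

/-- The pseudo-hyperbolic distance of the upper half-plane. -/
noncomputable def pseudoHypDist (z w : ℂ) : ℝ :=
  ‖(w - z) / (w - (starRingEnd ℂ) z)‖

/-- Type I (non-zero step): the steps `d (z_n, z_{n+1})` of the forward orbit `z_n = φ_n(i)`
have a positive limit. -/
def IsTypeI (φ : ℂ → ℂ) : Prop :=
  ∃ s : ℝ, 0 < s ∧
    Tendsto (fun n : ℕ => pseudoHypDist (φ^[n] Complex.I) (φ^[n + 1] Complex.I)) atTop (𝓝 s)

/-- Finite height: the imaginary parts of the forward orbit `z_n = φ_n(i)` have a finite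
limit. -/
def HasFiniteHeight (φ : ℂ → ℂ) : Prop :=
  ∃ L : ℝ, Tendsto (fun n : ℕ => (φ^[n] Complex.I).im) atTop (𝓝 L)

/-- Type Ia: non-zero step and finite height. -/
def IsTypeIa (φ : ℂ → ℂ) : Prop :=
  IsTypeI φ ∧ HasFiniteHeight φ

/-- `w` is a backward-iteration sequence with bounded steps (BISBS) for `φ` in the upper
half-plane. -/
structure IsBISBS (φ : ℂ → ℂ) (w : ℕ → ℂ) : Prop where
  im_pos : ∀ n : ℕ, 0 < (w n).im
  backward : ∀ n : ℕ, φ (w (n + 1)) = w n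
  bounded_steps : ∃ a : ℝ, a < 1 ∧ ∀ n : ℕ, pseudoHypDist (w n) (w (n + 1)) ≤ a

/-! Julia's lemma makes the displacement `p z = φ z - z` map into the closed upper half-plane, so
Schwarz–Pick applies to `p` itself (`schwarzPick_displacement`). Along the orbit `z_m` of `i` the
heights converge, so `Im p(z_m) → 0`. Hence the steps `p(z_m)` vary slowly, and the argument
condition makes them point right by at least some `s > 0` (`IsTypeIa.exists_step_bounds`). A
backward sequence going right at bounded height always has some late `z_m` within bounded distance,
and Schwarz–Pick gives `|p(z_m) - p(w_{n+1})| < s`. So `φ` moves `w_{n+1}` to the right as well: `Re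
w_n` is eventually nonincreasing and cannot tend to `∞`. -/

open Complex in
/-- Schwarz–Pick inequality for analytic self-maps of the open upper half-plane,
in terms of the pseudo-hyperbolic distance with denominators cleared. -/
theorem schwarzPick_of_im_pos {f : ℂ → ℂ} (hf : AnalyticOnNhd ℂ f {z : ℂ | 0 < z.im})
    (hpos : ∀ z : ℂ, 0 < z.im → 0 < (f z).im) {z w : ℂ} (hz : 0 < z.im) (hw : 0 < w.im) :
    ‖f z - f w‖ ^ 2 * (z.im * w.im) ≤ ‖z - w‖ ^ 2 * ((f z).im * (f w).im) := by
  have hsq : ∀ u v : ℂ, ‖u - (starRingEnd ℂ) v‖ ^ 2 = ‖u - v‖ ^ 2 + 4 * (u.im * v.im) := by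
    intro u v
    simp only [← normSq_eq_norm_sq, normSq_apply, sub_re, sub_im, conj_re, conj_im]
    ring
  have hne : ∀ u v : ℂ, 0 < u.im → 0 < v.im → u - (starRingEnd ℂ) v ≠ 0 := by
    intro u v hu hv h
    have := congrArg Complex.im h
    simp at this
    linarith
  have hlt : ∀ u v : ℂ, 0 < u.im → 0 < v.im → ‖u - v‖ < ‖u - (starRingEnd ℂ) v‖ := by
    intro u v hu hv
    have h1 := hsq u v
    have h2 := mul_pos hu hv
    exact lt_of_pow_lt_pow_left₀ 2 (norm_nonneg _) (by linarith)
  -- Cayley map from the disc with `ψ 0 = w`; it reduces the claim to the Schwarz lemma for `g`.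
  set ψ : ℂ → ℂ := fun ζ => (w - (starRingEnd ℂ) w * ζ) / (1 - ζ) with hψ
  have h1ζ : ∀ ζ ∈ Metric.ball (0 : ℂ) 1, (1 : ℂ) - ζ ≠ 0 := by
    intro ζ hζ h
    rw [mem_ball_zero_iff, ← sub_eq_zero.mp h] at hζ
    simp at hζ
  have hψim : ∀ ζ ∈ Metric.ball (0 : ℂ) 1, 0 < (ψ ζ).im := by
    intro ζ hζ
    have hn : 0 < normSq (1 - ζ) := normSq_pos.mpr (h1ζ ζ hζ)
    have hζ' : normSq ζ < 1 := by
      rw [normSq_eq_norm_sq]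
      rw [mem_ball_zero_iff] at hζ
      nlinarith [norm_nonneg ζ]
    have : (ψ ζ).im = w.im * (1 - normSq ζ) / normSq (1 - ζ) := by
      simp only [hψ, div_im]
      field_simp
      simp [normSq_apply]
      ring
    rw [this]
    exact div_pos (mul_pos hw (by linarith)) hn
  set g : ℂ → ℂ := fun ζ => (f (ψ ζ) - f w) / (f (ψ ζ) - (starRingEnd ℂ) (f w)) with hg
  have hgd : DifferentiableOn ℂ g (Metric.ball 0 1) := by
    have hψd : DifferentiableOn ℂ ψ (Metric.ball 0 1) := by
      apply DifferentiableOn.div (by fun_prop) (by fun_prop) h1ζ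
    have hfd : DifferentiableOn ℂ (fun ζ => f (ψ ζ)) (Metric.ball 0 1) :=
      hf.differentiableOn.comp hψd hψim
    exact (hfd.sub_const _).div (hfd.sub_const _)
      fun ζ hζ => hne _ _ (hpos _ (hψim ζ hζ)) (hpos _ hw)
  have hgm : Set.MapsTo g (Metric.ball 0 1) (Metric.ball 0 1) := by
    intro ζ hζ
    have hp := hpos _ (hψim ζ hζ)
    rw [mem_ball_zero_iff, hg, norm_div, div_lt_one (norm_pos_iff.mpr (hne _ _ hp (hpos _ hw)))]
    exact hlt _ _ hp (hpos _ hw)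
  have hg0 : g 0 = 0 := by simp [hg, hψ]
  set ζ : ℂ := (z - w) / (z - (starRingEnd ℂ) w) with hζdef
  have hzw := hne z w hz hw
  have hζ : ‖ζ‖ < 1 := by
    rw [hζdef, norm_div, div_lt_one (norm_pos_iff.mpr hzw)]
    exact hlt _ _ hz hw
  have hψζ : ψ ζ = z := by
    have h1 := h1ζ ζ (by simpa using hζ)
    rw [hψ]
    simp only
    rw [div_eq_iff h1, hζdef]
    field_simp
    ring
  have key := Complex.norm_le_norm_of_mapsTo_ball hgd
    (hgm.mono_right Metric.ball_subset_closedBall) hg0 hζ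
  simp only [hg, hψζ] at key
  rw [hζdef, norm_div, norm_div, div_le_div_iff₀
    (norm_pos_iff.mpr (hne _ _ (hpos _ hz) (hpos _ hw))) (norm_pos_iff.mpr hzw)] at key
  have key2 := pow_le_pow_left₀ (by positivity) key 2
  rw [mul_pow, mul_pow, hsq, hsq] at key2
  nlinarith

/-- Schwarz–Pick inequality for analytic maps of the open into the closed upper half-plane. -/
theorem schwarzPick_of_im_nonneg {f : ℂ → ℂ} (hf : AnalyticOnNhd ℂ f {z : ℂ | 0 < z.im})
    (hnn : ∀ z : ℂ, 0 < z.im → 0 ≤ (f z).im) {z w : ℂ} (hz : 0 < z.im) (hw : 0 < w.im) :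
    ‖f z - f w‖ ^ 2 * (z.im * w.im) ≤ ‖z - w‖ ^ 2 * ((f z).im * (f w).im) := by
  have h : ∀ δ : ℝ, 0 < δ → ‖f z - f w‖ ^ 2 * (z.im * w.im) ≤
      ‖z - w‖ ^ 2 * (((f z).im + δ) * ((f w).im + δ)) := by
    -- The shift by `δ * I` makes the image open; the displacement may be real-valued.
    intro δ hδ
    have := schwarzPick_of_im_pos (f := fun u => f u + δ * Complex.I)
      (hf.add analyticOnNhd_const) (fun u hu => by simpa using by linarith [hnn u hu]) hz hw
    simpa using this
  have hc : Tendsto (fun δ : ℝ => ‖z - w‖ ^ 2 * (((f z).im + δ) * ((f w).im + δ))) (𝓝[>] 0)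
      (𝓝 (‖z - w‖ ^ 2 * (((f z).im + 0) * ((f w).im + 0)))) :=
    (Continuous.tendsto (by fun_prop) _).mono_left nhdsWithin_le_nhds
  simpa using ge_of_tendsto hc (eventually_mem_nhdsWithin.mono h)

/-! ### Julia's lemma, the displacement and forward orbits -/

namespace IsParabolicAtInfinity

variable {φ : ℂ → ℂ}

theorem tendsto_div_imaginary_axis (hφ : IsParabolicAtInfinity φ) :
    Tendsto (fun y : ℝ => φ (y * Complex.I) / (y * Complex.I)) atTop (𝓝 1) := by
  refine (hφ.tendsto_div (Real.pi / 4) (by positivity) (by linarith [Real.pi_pos])).comp ?_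
  refine tendsto_inf.mpr ⟨?_, tendsto_principal.mpr ?_⟩
  · rw [← tendsto_norm_atTop_iff_cobounded]
    simpa using tendsto_abs_atTop_atTop
  · filter_upwards [eventually_gt_atTop 0] with y hy
    change |Complex.arg (y * Complex.I) - Real.pi / 2| < Real.pi / 4
    rw [Complex.arg_real_mul _ hy, Complex.arg_I]
    simpa using Real.pi_pos

/-- Julia's lemma at the boundary fixed point `∞`. -/
theorem im_le_im (hφ : IsParabolicAtInfinity φ) {w : ℂ} (hw : 0 < w.im) :
    w.im ≤ (φ w).im := by
  have h1 := hφ.tendsto_div_imaginary_axis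
  have hinv : Tendsto (fun y : ℝ => ((y : ℂ) * Complex.I)⁻¹) atTop (𝓝 0) := by
    refine tendsto_inv₀_cobounded.comp ?_
    rw [← tendsto_norm_atTop_iff_cobounded]
    simpa using tendsto_abs_atTop_atTop
  -- Schwarz–Pick for `iy` and `w`, divided by `y ^ 3`, becomes the claim as `y → ∞`.
  have hl : Tendsto (fun y : ℝ => ‖φ (y * Complex.I) / (y * Complex.I)
      - φ w * (y * Complex.I)⁻¹‖ ^ 2 * w.im) atTop (𝓝 (‖(1 : ℂ) - φ w * 0‖ ^ 2 * w.im)) :=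
    ((h1.sub (hinv.const_mul _)).norm.pow 2).mul_const _
  have hr : Tendsto (fun y : ℝ => ‖(1 : ℂ) - w * (y * Complex.I)⁻¹‖ ^ 2 *
      ((φ (y * Complex.I) / (y * Complex.I)).re * (φ w).im)) atTop
      (𝓝 (‖(1 : ℂ) - w * 0‖ ^ 2 * ((1 : ℂ).re * (φ w).im))) :=
    (((tendsto_const_nhds.sub (hinv.const_mul _)).norm.pow 2)).mul
      (((Complex.continuous_re.tendsto _).comp h1).mul_const _)
  have := le_of_tendsto_of_tendsto hl hr ?_
  · simpa using this
  · filter_upwards [eventually_gt_atTop 0] with y hy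
    have hyI : (y : ℂ) * Complex.I ≠ 0 := by simp [hy.ne']
    have hn : ‖(y : ℂ) * Complex.I‖ = y := by simp [abs_of_pos hy]
    have key := schwarzPick_of_im_nonneg hφ.analytic hφ.im_nonneg
      (z := y * Complex.I) (w := w) (by simpa using hy) hw
    have e1 : φ (y * Complex.I) / (y * Complex.I) - φ w * (y * Complex.I)⁻¹ =
        (φ (y * Complex.I) - φ w) / (y * Complex.I) := by ring
    have e2 : (1 : ℂ) - w * (y * Complex.I)⁻¹ = (y * Complex.I - w) / (y * Complex.I) := by
      rw [sub_div, div_self hyI, div_eq_mul_inv]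
    have e3 : (φ (y * Complex.I) / (y * Complex.I)).re = (φ (y * Complex.I)).im / y := by
      rw [mul_comm, ← div_div, Complex.div_ofReal_re, Complex.div_I]
      simp
    rw [e1, e2, e3, norm_div, norm_div, hn, div_pow, div_pow]
    have hy' : ((y : ℂ) * Complex.I).im = y := by simp
    rw [hy'] at key
    have h3 : 0 < y ^ 3 := by positivity
    calc _ = ‖φ (y * Complex.I) - φ w‖ ^ 2 * (y * w.im) / y ^ 3 := by field_simp
      _ ≤ ‖y * Complex.I - w‖ ^ 2 * ((φ (y * Complex.I)).im * (φ w).im) / y ^ 3 := by gcongr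
      _ = _ := by field_simp

theorem iterate_im_pos (hφ : IsParabolicAtInfinity φ) {z : ℂ} (hz : 0 < z.im) (n : ℕ) :
    0 < (φ^[n] z).im := by
  induction n with
  | zero => simpa using hz
  | succ n ih =>
    rw [Function.iterate_succ_apply']
    exact ih.trans_le (hφ.im_le_im ih)

theorem monotone_im_iterate (hφ : IsParabolicAtInfinity φ) {z : ℂ} (hz : 0 < z.im) :
    Monotone fun n : ℕ => (φ^[n] z).im :=
  monotone_nat_of_le_succ fun n => by
    rw [Function.iterate_succ_apply']
    exact hφ.im_le_im (hφ.iterate_im_pos hz n)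

/-- Schwarz–Pick inequality for the displacement `φ z - z`. -/
theorem schwarzPick_displacement (hφ : IsParabolicAtInfinity φ) {z w : ℂ} (hz : 0 < z.im)
    (hw : 0 < w.im) :
    ‖(φ z - z) - (φ w - w)‖ ^ 2 * (z.im * w.im) ≤
      ‖z - w‖ ^ 2 * ((φ z - z).im * (φ w - w).im) :=
  schwarzPick_of_im_nonneg (f := fun u => φ u - u) (hφ.analytic.sub analyticOnNhd_id)
    (fun u hu => by simpa using hφ.im_le_im hu) hz hw

theorem schwarzPick_iterate (hφ : IsParabolicAtInfinity φ) {z w : ℂ} (hz : 0 < z.im)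
    (hw : 0 < w.im) (n : ℕ) :
    ‖φ^[n] z - φ^[n] w‖ ^ 2 * (z.im * w.im) ≤
      ‖z - w‖ ^ 2 * ((φ^[n] z).im * (φ^[n] w).im) := by
  induction n with
  | zero => simp
  | succ n ih =>
    have hzn := hφ.iterate_im_pos hz n
    have hwn := hφ.iterate_im_pos hw n
    have h := schwarzPick_of_im_nonneg hφ.analytic hφ.im_nonneg hzn hwn
    rw [Function.iterate_succ_apply', Function.iterate_succ_apply']
    have hP := mul_pos hzn hwn
    have hV := mul_nonneg (hφ.im_nonneg _ hzn) (hφ.im_nonneg _ hwn)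
    refine le_of_mul_le_mul_right ?_ hP
    calc _ = ‖φ (φ^[n] z) - φ (φ^[n] w)‖ ^ 2 * ((φ^[n] z).im * (φ^[n] w).im)
          * (z.im * w.im) := by ring
      _ ≤ ‖φ^[n] z - φ^[n] w‖ ^ 2 * ((φ (φ^[n] z)).im * (φ (φ^[n] w)).im)
          * (z.im * w.im) := by gcongr
      _ = (‖φ^[n] z - φ^[n] w‖ ^ 2 * (z.im * w.im))
          * ((φ (φ^[n] z)).im * (φ (φ^[n] w)).im) := by ring
      _ ≤ (‖z - w‖ ^ 2 * ((φ^[n] z).im * (φ^[n] w).im))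
          * ((φ (φ^[n] z)).im * (φ (φ^[n] w)).im) := by gcongr
      _ = _ := by ring

/-- In the finite height case, the forward orbit of any point stays within bounded Euclidean
distance of the orbit of `i`. -/
theorem exists_norm_iterate_sub_le (hφ : IsParabolicAtInfinity φ) {L : ℝ}
    (hL : ∀ n : ℕ, (φ^[n] Complex.I).im ≤ L) {z : ℂ} (hz : 0 < z.im) :
    ∃ B : ℝ, ∀ n : ℕ, ‖φ^[n] z - φ^[n] Complex.I‖ ≤ B := by
  have hL1 : 1 ≤ L := by simpa using hL 0
  set c := ‖z - Complex.I‖ ^ 2 / z.im with hc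
  have hc0 : 0 ≤ c := by positivity
  refine ⟨c * L + L, fun n => ?_⟩
  set D := ‖φ^[n] z - φ^[n] Complex.I‖ with hD
  have hD0 : 0 ≤ D := norm_nonneg _
  have hI := hφ.iterate_im_pos (z := Complex.I) (by simp) n
  have h1 : D ^ 2 ≤ c * ((φ^[n] z).im * (φ^[n] Complex.I).im) := by
    have h := hφ.schwarzPick_iterate (z := z) (w := Complex.I) hz (by simp) n
    rw [Complex.I_im, mul_one, ← hD] at h
    rw [hc, div_mul_eq_mul_div, le_div_iff₀ hz]
    exact h
  have h2 : (φ^[n] z).im ≤ L + D := by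
    have := (le_abs_self _).trans (Complex.abs_im_le_norm (φ^[n] z - φ^[n] Complex.I))
    rw [Complex.sub_im] at this
    linarith [hL n]
  -- A quadratic inequality in `D`, which fails once `D > c * L + L`.
  have h3 : D ^ 2 ≤ c * ((L + D) * L) := h1.trans (by gcongr; exact hL n)
  by_contra! h
  nlinarith [mul_nonneg hc0 (by linarith : (0 : ℝ) ≤ L), mul_pos (sub_pos.mpr h) (sub_pos.mpr h)]

end IsParabolicAtInfinity

/-! ### Backward sequences and real parts tending to infinity -/

theorem IsBISBS.im_antitone {φ : ℂ → ℂ} (hφ : IsParabolicAtInfinity φ) {w : ℕ → ℂ}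
    (hw : IsBISBS φ w) : Antitone fun n => (w n).im :=
  antitone_nat_of_succ_le fun n => by
    have := hφ.im_le_im (hw.im_pos (n + 1))
    rwa [hw.backward] at this

/-- The Euclidean steps of a backward-iteration sequence with bounded steps are controlled by the
heights. -/
theorem IsBISBS.exists_norm_step_le {φ : ℂ → ℂ} {w : ℕ → ℂ} (hw : IsBISBS φ w) :
    ∃ C : ℝ, 0 ≤ C ∧ ∀ n, ‖w n - w (n + 1)‖ ≤ C * (w (n + 1)).im := by
  obtain ⟨a, ha, hstep⟩ := hw.bounded_steps
  have ha0 : 0 ≤ a := (norm_nonneg _).trans (hstep 0)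
  -- With `d` the Euclidean step, `d ≤ a * (d + 2 * (w (n + 1)).im)`; solve for `d`.
  refine ⟨2 * a / (1 - a), div_nonneg (by linarith) (by linarith), fun n => ?_⟩
  have hn := hw.im_pos n
  have hn1 := hw.im_pos (n + 1)
  have hden : w (n + 1) - (starRingEnd ℂ) (w n) ≠ 0 := by
    intro h
    have := congrArg Complex.im h
    simp at this
    linarith
  have h := hstep n
  rw [pseudoHypDist, norm_div, div_le_iff₀ (norm_pos_iff.mpr hden), norm_sub_rev] at h
  have h2 : ‖w (n + 1) - (starRingEnd ℂ) (w n)‖ ≤ ‖w n - w (n + 1)‖ + 2 * (w (n + 1)).im := by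
    have e : w (n + 1) - (starRingEnd ℂ) (w n) =
        (starRingEnd ℂ) (w (n + 1) - w n) + 2 * (w (n + 1)).im * Complex.I := by
      apply Complex.ext <;> simp
      ring
    rw [e]
    refine (norm_add_le _ _).trans (le_of_eq ?_)
    rw [RCLike.norm_conj, norm_sub_rev]
    simp [abs_of_pos hn1]
  rw [div_mul_eq_mul_div, le_div_iff₀ (by linarith)]
  nlinarith [mul_le_mul_of_nonneg_left h2 ha0]

theorem tendsto_re_atTop_of_arg_tendsto_zero {w : ℕ → ℂ} {M : ℝ} (hM : ∀ n, |(w n).im| ≤ M)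
    (hinf : Tendsto w atTop (Bornology.cobounded ℂ))
    (harg : Tendsto (fun n => Complex.arg (w n)) atTop (𝓝 0)) :
    Tendsto (fun n => (w n).re) atTop atTop := by
  have hn : Tendsto (fun n => ‖w n‖ - M) atTop atTop :=
    tendsto_atTop_add_const_right _ _ (tendsto_norm_atTop_iff_cobounded.mpr hinf)
  refine tendsto_atTop_mono' _ ?_ hn
  have harg' : ∀ᶠ n in atTop, |Complex.arg (w n)| < Real.pi / 2 := by
    have := harg.abs
    rw [abs_zero] at this
    exact this.eventually_lt_const (by positivity)
  filter_upwards [harg'] with n h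
  have hre : 0 ≤ (w n).re := by
    rcases Complex.abs_arg_lt_pi_div_two_iff.mp h with h | h
    · exact h.le
    · simp [h]
  have := Complex.norm_le_abs_re_add_abs_im (w n)
  rw [abs_of_nonneg hre] at this
  linarith [hM n]

/-- A real sequence tending to `∞` whose steps are at most `B` passes within `B` of
every large real number, at late times. -/
theorem exists_near_of_tendsto_atTop {x : ℕ → ℝ} {B : ℝ} (hx : Tendsto x atTop atTop)
    (hB : ∀ n, x (n + 1) - x n ≤ B) (N : ℕ) {t : ℝ} (ht : x N < t) :
    ∃ m, N ≤ m ∧ |x m - t| ≤ B := by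
  classical
  have hex : ∃ k, t ≤ x (N + k) := by
    obtain ⟨m, hm1, hm2⟩ := ((hx.eventually_ge_atTop t).and (eventually_ge_atTop N)).exists
    exact ⟨m - N, by rwa [Nat.add_sub_cancel' hm2]⟩
  have h1 := Nat.find_spec hex
  obtain ⟨k, hk⟩ : ∃ k, Nat.find hex = k + 1 := by
    apply Nat.exists_eq_succ_of_ne_zero
    intro h0
    rw [h0] at h1
    exact absurd h1 (by simpa using ht)
  have h2 := Nat.find_min hex (m := k) (by omega)
  rw [hk] at h1
  push Not at h2
  refine ⟨N + (k + 1), by omega, ?_⟩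
  have := hB (N + k)
  rw [add_assoc] at this
  rw [abs_of_nonneg (by linarith)]
  linarith

/-! ### Direction of the forward orbit -/

/-- In type Ia with orbits asymptotic to the positive real direction, the orbit of `i` eventually
moves to the right by steps bounded from below, and all its steps are bounded. -/
theorem IsTypeIa.exists_step_bounds {φ : ℂ → ℂ} (hIa : IsTypeIa φ)
    (hφ : IsParabolicAtInfinity φ) {z₀ : ℂ} (hz₀ : 0 < z₀.im)
    (harg : Tendsto (fun n : ℕ => Complex.arg (φ^[n] z₀)) atTop (𝓝 0)) :
    ∃ s B : ℝ, 0 < s ∧ (∀ n, ‖φ^[n + 1] Complex.I - φ^[n] Complex.I‖ ≤ B) ∧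
      ∀ᶠ n in atTop, s ≤ (φ^[n + 1] Complex.I).re - (φ^[n] Complex.I).re := by
  obtain ⟨⟨s, hs, hd⟩, L, hL⟩ := hIa
  have hI0 : 0 < Complex.I.im := by simp
  have hmono := hφ.monotone_im_iterate hI0
  have hle : ∀ n, (φ^[n] Complex.I).im ≤ L := fun n => hmono.ge_of_tendsto hL n
  obtain ⟨B, hB⟩ : ∃ B : ℝ, ∀ n, ‖φ^[n + 1] Complex.I - φ^[n] Complex.I‖ ≤ B := by
    obtain ⟨B, hB⟩ := hφ.exists_norm_iterate_sub_le hle (hφ.iterate_im_pos hI0 1)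
    exact ⟨B, fun n => by simpa using hB n⟩
  set x : ℕ → ℝ := fun n => (φ^[n] Complex.I).re with hx
  set y : ℕ → ℝ := fun n => (φ^[n] Complex.I).im with hy
  have hy1 : ∀ n, 1 ≤ y n := fun n => by simpa [hy] using hmono (Nat.zero_le n)
  have hη : Tendsto (fun n => y (n + 1) - y n) atTop (𝓝 0) := by
    simpa using (hL.comp (tendsto_add_atTop_nat 1)).sub hL
  have hη0 : ∀ n, 0 ≤ y (n + 1) - y n := fun n => sub_nonneg.mpr (hmono n.le_succ)
  -- The denominator of the step is at least 2, so the Euclidean step exceeds `3 / 2 * s`; its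
  -- vertical part takes less than `s / 2`.
  have hlow : ∀ᶠ n in atTop, s ≤ |x (n + 1) - x n| := by
    filter_upwards [hd.eventually_const_lt (by linarith : 3 / 4 * s < s),
      hη.eventually_lt_const (by linarith : 0 < s / 2)] with n h1 h2
    have hden : 2 ≤ ‖φ^[n + 1] Complex.I - (starRingEnd ℂ) (φ^[n] Complex.I)‖ := by
      refine le_trans ?_ (Complex.abs_im_le_norm _)
      refine le_trans ?_ (le_abs_self _)
      simp only [Complex.sub_im, Complex.conj_im]
      linarith [hy1 n, hy1 (n + 1)]
    rw [pseudoHypDist, norm_div, lt_div_iff₀ (by linarith)] at h1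
    have h3 := Complex.norm_le_abs_re_add_abs_im (φ^[n + 1] Complex.I - φ^[n] Complex.I)
    rw [Complex.sub_re, Complex.sub_im] at h3
    have h4 := abs_of_nonneg (hη0 n)
    simp only [hx, hy] at h2 h4 ⊢
    nlinarith
  -- Horizontal steps of size at least `s` that change by less than `s` keep their sign.
  have hdiff : ∀ᶠ n in atTop, |(x (n + 2) - x (n + 1)) - (x (n + 1) - x n)| < s := by
    have hlim : Tendsto (fun n => B ^ 2 * ((y (n + 2) - y (n + 1)) * (y (n + 1) - y n))) atTop
        (𝓝 0) := by
      simpa using ((hη.comp (tendsto_add_atTop_nat 1)).mul hη).const_mul (B ^ 2)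
    filter_upwards [hlim.eventually_lt_const (by positivity : 0 < s ^ 2)] with n hn
    have hsp := hφ.schwarzPick_displacement (hφ.iterate_im_pos hI0 (n + 1))
      (hφ.iterate_im_pos hI0 n)
    simp only [← Function.iterate_succ_apply' φ] at hsp
    set A := φ^[n + 1 + 1] Complex.I - φ^[n + 1] Complex.I
      - (φ^[n + 1] Complex.I - φ^[n] Complex.I) with hA
    have hA1 : ‖A‖ ^ 2 ≤ B ^ 2 * ((y (n + 2) - y (n + 1)) * (y (n + 1) - y n)) := by
      calc ‖A‖ ^ 2 ≤ ‖A‖ ^ 2 * (y (n + 1) * y n) :=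
            le_mul_of_one_le_right (by positivity)
              (one_le_mul_of_one_le_of_one_le (hy1 _) (hy1 _))
        _ ≤ _ := hsp
        _ ≤ _ := by
          rw [Complex.sub_im, Complex.sub_im]
          exact mul_le_mul_of_nonneg_right (pow_le_pow_left₀ (norm_nonneg _) (hB n) 2)
            (mul_nonneg (hη0 (n + 1)) (hη0 n))
    have hA2 : ‖A‖ < s := lt_of_pow_lt_pow_left₀ 2 hs.le (hA1.trans_lt hn)
    have hA3 := Complex.abs_re_le_norm A
    simp only [hA, Complex.sub_re] at hA3
    exact hA3.trans_lt hA2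
  obtain ⟨N, hN⟩ := eventually_atTop.mp (hlow.and hdiff)
  refine ⟨s, B, hs, hB, ?_⟩
  rcases le_abs'.mp (hN N le_rfl).1 with hneg | hpos
  -- Leftward steps would drive the orbit of `i` to `-∞`, yet it stays near the orbit of `z₀`, whose
  -- real parts are eventually nonnegative.
  · exfalso
    have hall : ∀ k, x (N + k + 1) - x (N + k) ≤ -s := by
      intro k
      induction k with
      | zero => exact hneg
      | succ k ih =>
        have h1 := (abs_lt.mp (hN (N + k) (by omega)).2).2
        rcases le_abs'.mp (hN (N + (k + 1)) (by omega)).1 with h | h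
        · exact h
        · simp only [← add_assoc] at h ⊢
          linarith
    have hsum : ∀ k : ℕ, x (N + k) ≤ x N - k * s := by
      intro k
      induction k with
      | zero => simp
      | succ k ih =>
        have := hall k
        push_cast
        rw [← add_assoc]
        linarith
    obtain ⟨D, hD⟩ := hφ.exists_norm_iterate_sub_le hle hz₀
    have hre : ∀ᶠ n in atTop, 0 ≤ (φ^[n] z₀).re := by
      have := harg.abs
      rw [abs_zero] at this
      filter_upwards [this.eventually_lt_const (by positivity : 0 < Real.pi / 2)] with n h
      rcases Complex.abs_arg_lt_pi_div_two_iff.mp h with h | h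
      · exact h.le
      · simp [h]
    obtain ⟨N', hN'⟩ := eventually_atTop.mp hre
    obtain ⟨k, hk⟩ := exists_nat_gt ((x N + D) / s)
    rw [div_lt_iff₀ hs] at hk
    have h1 := hN' (N + (k + N')) (by omega)
    have h2 := (le_abs_self _).trans ((Complex.abs_re_le_norm _).trans (hD (N + (k + N'))))
    rw [Complex.sub_re] at h2
    have h3 := hsum (k + N')
    have h4 : 0 ≤ (N' : ℝ) * s := by positivity
    push_cast at h3
    simp only [hx] at h3 hk
    linarith
  · refine eventually_atTop.mpr ⟨N, fun n hn => ?_⟩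
    induction n, hn using Nat.le_induction with
    | base => exact hpos
    | succ n hn ih =>
      have h1 := (abs_lt.mp (hN n hn).2).1
      rcases le_abs'.mp (hN (n + 1) (by omega)).1 with h | h
      · simp only [hx] at h1 h
        exfalso
        linarith
      · exact h

/-! ### Comparison of forward and backward orbits -/

theorem corollary1p20 (φ : ℂ → ℂ) (hφ : IsParabolicAtInfinity φ) (hIa : IsTypeIa φ)
    (z₀ : ℂ) (hz₀ : 0 < z₀.im)
    (harg : Tendsto (fun n : ℕ => Complex.arg (φ^[n] z₀)) atTop (𝓝 0)) :
    ¬ ∃ w : ℕ → ℂ, IsBISBS φ w ∧ Tendsto w atTop (Bornology.cobounded ℂ) ∧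
      Tendsto (fun n : ℕ => Complex.arg (w n)) atTop (𝓝 0) := by
  rintro ⟨w, hw, hinf, hwarg⟩
  obtain ⟨s, B, hs, hB, hstep⟩ := hIa.exists_step_bounds hφ hz₀ harg
  obtain ⟨-, L, hL⟩ := hIa
  obtain ⟨C, hC, hwC⟩ := hw.exists_norm_step_le
  have hI0 : 0 < Complex.I.im := by simp
  have hmono := hφ.monotone_im_iterate hI0
  have hle : ∀ n, (φ^[n] Complex.I).im ≤ L := fun n => hmono.ge_of_tendsto hL n
  have hy1 : ∀ n, 1 ≤ (φ^[n] Complex.I).im := fun n => by simpa using hmono (Nat.zero_le n)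
  have hη : Tendsto (fun n => (φ^[n + 1] Complex.I).im - (φ^[n] Complex.I).im) atTop (𝓝 0) := by
    simpa using (hL.comp (tendsto_add_atTop_nat 1)).sub hL
  have hwM : ∀ n, (w n).im ≤ (w 0).im := fun n => hw.im_antitone hφ (Nat.zero_le n)
  have hwre : Tendsto (fun n => (w n).re) atTop atTop :=
    tendsto_re_atTop_of_arg_tendsto_zero
      (fun n => (abs_of_pos (hw.im_pos n)).trans_le (hwM n)) hinf hwarg
  have hzre : Tendsto (fun n => (φ^[n] Complex.I).re) atTop atTop := by
    obtain ⟨N, hN⟩ := eventually_atTop.mp hstep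
    rw [← tendsto_add_atTop_iff_nat N]
    have hlin : Tendsto (fun k : ℕ => (φ^[N] Complex.I).re + k * s) atTop atTop :=
      tendsto_atTop_add_const_left _ _ (tendsto_natCast_atTop_atTop.atTop_mul_const hs)
    refine tendsto_atTop_mono (fun k => ?_) hlin
    induction k with
    | zero => simp
    | succ k ih =>
      have := hN (k + N) (by omega)
      rw [show k + 1 + N = k + N + 1 by omega]
      push_cast
      linarith
  -- Bounds `|z_m - w_{n+1}|`: `B` horizontally, the two heights vertically.
  set K := B + (L + (w 0).im) with hK
  have hlim : Tendsto (fun n => K ^ 2 * C *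
      ((φ^[n + 1] Complex.I).im - (φ^[n] Complex.I).im)) atTop (𝓝 0) := by
    simpa using hη.const_mul (K ^ 2 * C)
  obtain ⟨N, hN⟩ := eventually_atTop.mp
    (hstep.and (hlim.eventually_lt_const (by positivity : 0 < s ^ 2)))
  obtain ⟨n₀, hn₀⟩ := eventually_atTop.mp (hwre.eventually_gt_atTop (φ^[N] Complex.I).re)
  have hdec : ∀ n, n₀ ≤ n → (w (n + 1)).re ≤ (w n).re := by
    intro n hn
    obtain ⟨m, hm, hmt⟩ := exists_near_of_tendsto_atTop hzre
      (fun k => by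
        have := (le_abs_self _).trans ((Complex.abs_re_le_norm _).trans (hB k))
        rwa [Complex.sub_re] at this) N (hn₀ (n + 1) (by omega))
    obtain ⟨hms, hmη⟩ := hN m hm
    have hwi := hw.im_pos (n + 1)
    have hsp := hφ.schwarzPick_displacement (hφ.iterate_im_pos hI0 m) hwi
    rw [hw.backward, ← Function.iterate_succ_apply' φ] at hsp
    set A := φ^[m + 1] Complex.I - φ^[m] Complex.I - (w n - w (n + 1)) with hA
    set η := (φ^[m + 1] Complex.I).im - (φ^[m] Complex.I).im with hηdef
    have hη0 : 0 ≤ η := sub_nonneg.mpr (hmono m.le_succ)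
    have hdist : ‖φ^[m] Complex.I - w (n + 1)‖ ≤ K := by
      refine (Complex.norm_le_abs_re_add_abs_im _).trans ?_
      rw [Complex.sub_re, Complex.sub_im]
      refine add_le_add hmt ?_
      rw [abs_le]
      constructor <;> linarith [hle m, hwM (n + 1), hy1 m]
    -- Bounded steps enter here: this factor `(w (n + 1)).im` cancels the one in Schwarz–Pick, so
    -- the estimate survives heights tending to 0.
    have hpim : (w n - w (n + 1)).im ≤ C * (w (n + 1)).im :=
      (le_abs_self _).trans ((Complex.abs_im_le_norm _).trans (hwC n))
    have hpim0 : 0 ≤ (w n - w (n + 1)).im := by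
      rw [Complex.sub_im]
      exact sub_nonneg.mpr (hw.im_antitone hφ n.le_succ)
    have hA1 : ‖A‖ ^ 2 ≤ K ^ 2 * C * η := by
      refine le_of_mul_le_mul_right ?_ hwi
      calc ‖A‖ ^ 2 * (w (n + 1)).im
          ≤ ‖A‖ ^ 2 * ((φ^[m] Complex.I).im * (w (n + 1)).im) := by
            gcongr
            exact le_mul_of_one_le_left hwi.le (hy1 m)
        _ ≤ _ := hsp
        _ ≤ K ^ 2 * (η * (C * (w (n + 1)).im)) := by
          rw [Complex.sub_im (φ^[m + 1] Complex.I), ← hηdef]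
          gcongr
        _ = _ := by ring
    -- The step of `z_m` has real part at least `s`, so the step from `w (n + 1)` to `w n` has
    -- positive real part.
    have hA2 : ‖A‖ < s := lt_of_pow_lt_pow_left₀ 2 hs.le (hA1.trans_lt hmη)
    have hA3 := (le_abs_self _).trans (Complex.abs_re_le_norm A)
    simp only [hA, Complex.sub_re] at hA3 hA2
    linarith
  obtain ⟨n, hn1, hn2⟩ := ((hwre.eventually_gt_atTop (w n₀).re).and
    (eventually_ge_atTop n₀)).exists
  have hbound : (w n).re ≤ (w n₀).re := by
    clear hn1
    induction n, hn2 using Nat.le_induction with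
    | base => exact le_rfl
    | succ n hn ih => exact (hdec n hn).trans ih
  linarith
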